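/- **The language ECPS.** Fix a set $\Sigma$ of effect operations. Types are $A ::= \neg(A_1,\ldots,A_n)\mid \mathtt{nat}\mid\mathtt{unit}$. Values and computations are $$v,w ::= x \mid \mathtt{zero}\mid \mathtt{succ}(v)\mid \star\mid \lambda(x_1,\ldots,x_n){:}(A_1,\ldots,A_n).\,t,$$ $$s,t ::= v(w_1,\ldots,w_n)\mid (\mu x.v)(w_1,\ldots,w_n)\mid \sigma(v,x.t)\ (\sigma\in\Sigma)\mid\ \downarrow\ \mid \mathtt{case}\ v\ \mathtt{in}\ \{\mathtt{zero}\Rightarrow s,\ \mathtt{succ}(x)\Rightarrow t\},$$ taken up to renaming of bound variables. Values are typed, $\Gamma\vdash v:A$; computations are only well-formed, $\Gamma\vdash t$. Variables, $\mathtt{zero}$, $\mathtt{succ}$ and $\star$ are typed as usual and $\Gamma\vdash\ \downarrow$. Further, $\Gamma\vdash\lambda(\vec x){:}(\vec A).t:\neg(\vec A)$ if $\Gamma,\vec x{:}\vec A\vdash t$; $\Gamma\vdash v(\vec w)$ if $\Gamma\vdash v:\neg(\vec A)$ and $\Gamma\vdash w_i:A_i$ for all $i$; $\Gamma\vdash(\mu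 x.v)(\vec w)$ if $\Gamma,x{:}\neg(\vec A)\vdash v:\neg(\vec A)$ and $\Gamma\vdash w_i:A_i$ for all $i$; $\Gamma\vdash\sigma(v,x.t)$ if $\Gamma\vdash v:\mathtt{nat}$ and $\Gamma,x{:}\mathtt{nat}\vdash t$; and a $\mathtt{case}$ is well-formed if $\Gamma\vdash v:\mathtt{nat}$, $\Gamma\vdash s$ and $\Gamma,x{:}\mathtt{nat}\vdash t$. Write $\overline n=\mathtt{succ}^n(\mathtt{zero})$. **Effect trees.** Closed computations reduce by $(\lambda(\vec x){:}(\vec A).t)(\vec w)\to t[\vec w/\vec x]$, $(\mu x.v)(\vec w)\to (v[\lambda(\vec y){:}(\vec A).(\mu x.v)(\vec y)/x])(\vec w)$, $\mathtt{case}\ \mathtt{zero}\ \mathtt{in}\ \{\mathtt{zero}\Rightarrow s,\mathtt{succ}(x)\Rightarrow t\}\to s$ and $\mathtt{case}\ \mathtt{succ}(v)\ \mathtt{in}\ \{\mathtt{zero}\Rightarrow s,\mathtt{succ}(x)\Rightarrow t\}\to t[v/x]$. Let $\mathit{Trees}_\Sigma$ be the set of possibly infinite trees with leaves $\bot$ and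 $\downarrow$ and with nodes $\sigma_n(tr_0,tr_1,\ldots)$, $\sigma\in\Sigma$, $n\in\mathbb N$, that have one child for each natural number; put $tr\le tr'$ if $tr$ arises from $tr'$ by replacing subtrees by $\bot$. For a closed computation $t$ let $[\![t]\!]_0=\bot$, and let $[\![t]\!]_{n+1}$ be $[\![s]\!]_n$ if $t\to s$, be $\sigma_m([\![s[\overline 0/x]]\!]_n,[\![s[\overline 1/x]]\!]_n,\ldots)$ if $t=\sigma(\overline m,x.s)$, and be $\downarrow$ if $t=\ \downarrow$. Let $[\![t]\!]=\bigsqcup_n[\![t]\!]_n$. **Observations.** Let $\mathfrak P$ be a set of subsets of $\mathit{Trees}_\Sigma$. It is *decomposable* if whenever $\sigma_n(tr_0,tr_1,\ldots)\in P\in\mathfrak P$ there are $P'_0,P'_1,\ldots\in\mathfrak P$ with $tr_k\in P'_k$ for all $k$ such that $\sigma_n(p_0,p_1,\ldots)\in P$ whenever $p_k\in P'_k$ for all $k$. A set $X$ of trees is *Scott-open* if it is upwards closed and every ascending sequence $tr_0\le tr_1\le\cdots$ with least upper bound in $X$ has a member in $X$. $\mathfrak P$ is *consistent* if there are $P_0\in\mathfrak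 P$ with $P_0\ne\mathit{Trees}_\Sigma$ and a closed computation $t_0$ with $[\![t_0]\!]\in P_0$. **Relations.** A well-typed relation relates values of the same type, or computations, in the same context. The *open extension* $\mathcal R^\circ$ of a well-typed relation $\mathcal R$ on closed terms relates two terms in context $\vec x{:}\vec A$ if $\mathcal R$ relates their instances under every substitution of closed values $\vec u{:}\vec A$ for $\vec x$. *Applicative bisimilarity* $\sim$ is the union of all symmetric well-typed relations $\mathcal R$ on closed terms such that related values of type $\mathtt{unit}$ or $\mathtt{nat}$ are equal; $s\mathrel{\mathcal R}t$ implies $[\![s]\!]\in P\Rightarrow[\![t]\!]\in P$ for all $P\in\mathfrak P$; and $v\mathrel{\mathcal R}u$ at type $\neg(\vec A)$ implies $v(\vec w)\mathrel{\mathcal R}u(\vec w)$ for all closed $\vec w{:}\vec A$. *The logic $\mathcal F$.* Value formulas are $\{n\}:\mathtt{nat}$ for $n\in\mathbb N$; $(\phi_1,\ldots,\phi_n)\mapsto P:\neg(A_1,\ldots,A_n)$ for $\phi_i:A_i$ and $P\in\mathfrak P$; and, at every type, arbitrary (set-indexed) disjunctions and conjunctions, and negation. For closed values, $v\models\{n\}$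 iff $v=\overline n$; $v\models(\phi_1,\ldots,\phi_n)\mapsto P$ iff $[\![v(w_1,\ldots,w_n)]\!]\in P$ for all closed $w_i:A_i$ with $w_i\models\phi_i$; connectives are interpreted as usual. Computation formulas are the $P\in\mathfrak P$, and $t\models P$ iff $[\![t]\!]\in P$. $\mathcal F^+$ is the fragment of formulas without negation. For $\mathcal L\in\{\mathcal F,\mathcal F^+\}$ the *logical preorder* $t_1\sqsubseteq_{\mathcal L}t_2$ on closed terms says that $t_2$ satisfies every formula of $\mathcal L$ that $t_1$ satisfies; *logical equivalence* $t_1\equiv_{\mathcal F}t_2$ means $t_1\sqsubseteq_{\mathcal F}t_2$ and $t_2\sqsubseteq_{\mathcal F}t_1$. *Contextual preorder and equivalence.* A well-typed relation on possibly open terms is *compatible* if it relates each of $x$, $\star$, $\mathtt{zero}$, $\downarrow$ to itself and is preserved by all other term constructors. It is *$\mathfrak P$-adequate* (*$\mathfrak P$-biadequate*) if for related closed computations $s,t$ and all $P\in\mathfrak P$, $[\![s]\!]\in P$ implies (is equivalent to) $[\![t]\!]\in P$. The *contextual preorder* $\sqsubseteq_{ctx}$ is the union of all compatible $\mathfrak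 P$-adequate relations, and *contextual equivalence* $\equiv_{ctx}$ is the union of all compatible $\mathfrak P$-biadequate relations. **Theorem.** Let $\mathfrak P$ be a decomposable and consistent set of Scott-open observations. Then 1. $(\sqsubseteq_{\mathcal F^+})^\circ=\ \sqsubseteq_{ctx}$; 2. $(\equiv_{\mathcal F})^\circ=\ \equiv_{ctx}$. Hence applicative bisimilarity, $\mathcal F$-logical equivalence and contextual equivalence all coincide: $\sim\ =\ \equiv_{\mathcal F}$ on closed terms, and $\sim^\circ=\ \equiv_{ctx}$. -/

import Mathlib

universe u

namespace ECPS

/-! ## Syntax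

Terms are the well-typed terms, up to renaming of bound variables: a term is built together with
its typing derivation and variables are de Bruijn indices.  (Function abstractions carry the types
of their arguments, so a term has at most one typing derivation in a given context.) -/

/-- Types `¬(A₁,…,Aₙ) | nat | unit`. -/
inductive Ty : Type
  | unit : Ty
  | nat : Ty
  | neg (As : List Ty) : Ty

/-- A context lists the types of the free variables. -/
abbrev Ctx : Type := List Ty

/-- A term is either a value of some type, `Γ ⊢ v : A`, or a computation, `Γ ⊢ t`. -/
inductive Kind : Type
  | val (A : Ty) : Kind
  | comp : Kind

/-- `Var Γ A` is the set of positions of the list `Γ` at which the type `A` stands, that is,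
the set of variables of type `A` in the context `Γ`. -/
inductive Var : Ctx → Ty → Type
  | here {Γ : Ctx} {A : Ty} : Var (A :: Γ) A
  | there {Γ : Ctx} {A B : Ty} (x : Var Γ A) : Var (B :: Γ) A

/-- Values and computations over the set `Sig` of effect operations.  A tuple `(w₁,…,wₙ)` of values
of types `As = (A₁,…,Aₙ)` is given as a function that sends each position in `As` to a value of
the type that stands there. -/
inductive Tm (Sig : Type u) : Ctx → Kind → Type u
  | var {Γ : Ctx} {A : Ty} (x : Var Γ A) : Tm Sig Γ (.val A)
  | zero {Γ : Ctx} : Tm Sig Γ (.val .nat)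
  | succ {Γ : Ctx} (v : Tm Sig Γ (.val .nat)) : Tm Sig Γ (.val .nat)
  | star {Γ : Ctx} : Tm Sig Γ (.val .unit)
  /-- `λ(x₁,…,xₙ):(A₁,…,Aₙ). t` -/
  | lam {Γ : Ctx} (As : List Ty) (t : Tm Sig (As ++ Γ) .comp) : Tm Sig Γ (.val (.neg As))
  /-- `v (w₁,…,wₙ)` -/
  | app {Γ : Ctx} {As : List Ty} (v : Tm Sig Γ (.val (.neg As)))
      (w : ∀ A, Var As A → Tm Sig Γ (.val A)) : Tm Sig Γ .comp
  /-- `(μx. v)(w₁,…,wₙ)` -/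
  | mu {Γ : Ctx} {As : List Ty} (v : Tm Sig (.neg As :: Γ) (.val (.neg As)))
      (w : ∀ A, Var As A → Tm Sig Γ (.val A)) : Tm Sig Γ .comp
  /-- `σ(v, x.t)` -/
  | op {Γ : Ctx} (σ : Sig) (v : Tm Sig Γ (.val .nat)) (t : Tm Sig (.nat :: Γ) .comp) :
      Tm Sig Γ .comp
  /-- the termination effect `↓` -/
  | halt {Γ : Ctx} : Tm Sig Γ .comp
  /-- `case v in {zero ⇒ s, succ(x) ⇒ t}` -/
  | case {Γ : Ctx} (v : Tm Sig Γ (.val .nat)) (s : Tm Sig Γ .comp)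
      (t : Tm Sig (.nat :: Γ) .comp) : Tm Sig Γ .comp

/-- Values `Γ ⊢ v : A`. -/
abbrev Val (Sig : Type u) (Γ : Ctx) (A : Ty) : Type u := Tm Sig Γ (.val A)

/-- Computations `Γ ⊢ t`. -/
abbrev Comp (Sig : Type u) (Γ : Ctx) : Type u := Tm Sig Γ .comp

/-- The numeral `succⁿ(zero)`. -/
def num {Sig : Type u} {Γ : Ctx} : ℕ → Val Sig Γ .nat
  | 0 => .zero
  | n + 1 => .succ (num n)

/-! ## Renaming and substitution -/

/-- Renamings of the variables of `Γ` by variables of `Δ`. -/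
abbrev Ren (Γ Δ : Ctx) : Type := ∀ A, Var Γ A → Var Δ A

/-- Extend a renaming to one further variable. -/
def Ren.lift {Γ Δ : Ctx} (ρ : Ren Γ Δ) (B : Ty) : Ren (B :: Γ) (B :: Δ)
  | _, .here => .here
  | _, .there x => .there (ρ _ x)

/-- Extend a renaming to a list of further variables. -/
def Ren.lifts {Γ Δ : Ctx} (ρ : Ren Γ Δ) : (As : List Ty) → Ren (As ++ Γ) (As ++ Δ)
  | [] => ρ
  | B :: As => (Ren.lifts ρ As).lift B

/-- The inclusion of the first variables `As` into `As ++ Γ`. -/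
def Ren.inl {Γ : Ctx} : (As : List Ty) → Ren As (As ++ Γ)
  | _ :: _, _, .here => .here
  | _ :: As, _, .there x => .there (Ren.inl As _ x)

/-- The inclusion of the variables `Γ` into `As ++ Γ`. -/
def Ren.inr {Γ : Ctx} : (As : List Ty) → Ren Γ (As ++ Γ)
  | [], _, x => x
  | _ :: As, _, x => .there (Ren.inr As _ x)

/-- Capture-avoiding renaming. -/
def Tm.rename {Sig : Type u} : {Γ : Ctx} → {K : Kind} → Tm Sig Γ K →
    {Δ : Ctx} → Ren Γ Δ → Tm Sig Δ K
  | _, _, .var x, _, ρ => .var (ρ _ x)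
  | _, _, .zero, _, _ => .zero
  | _, _, .succ v, _, ρ => .succ (v.rename ρ)
  | _, _, .star, _, _ => .star
  | _, _, .lam As t, _, ρ => .lam As (t.rename (ρ.lifts As))
  | _, _, .app v w, _, ρ => .app (v.rename ρ) (fun A x => (w A x).rename ρ)
  | _, _, .mu v w, _, ρ => .mu (v.rename (ρ.lift _)) (fun A x => (w A x).rename ρ)
  | _, _, .op σ v t, _, ρ => .op σ (v.rename ρ) (t.rename (ρ.lift _))
  | _, _, .halt, _, _ => .halt
  | _, _, .case v s t, _, ρ => .case (v.rename ρ) (s.rename ρ) (t.rename (ρ.lift _))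

/-- Substitutions of values in context `Δ` for the variables of `Γ`; equivalently, tuples of values
in context `Δ` whose types are listed by `Γ`. -/
abbrev Sub (Sig : Type u) (Γ Δ : Ctx) : Type u := ∀ A, Var Γ A → Val Sig Δ A

/-- The identity substitution. -/
def Sub.id {Sig : Type u} {Γ : Ctx} : Sub Sig Γ Γ := fun _ x => .var x

/-- The substitution that sends the first variable to `v` and acts as `θ` on the others. -/
def Sub.cons {Sig : Type u} {Γ Δ : Ctx} {B : Ty} (v : Val Sig Δ B) (θ : Sub Sig Γ Δ) :
    Sub Sig (B :: Γ) Δ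
  | _, .here => v
  | _, .there x => θ _ x

/-- The substitution that sends the variables of `As` to the tuple `w` and acts as `θ` on the
others. -/
def Sub.append {Sig : Type u} {Γ Δ : Ctx} : {As : List Ty} → (w : Sub Sig As Δ) →
    (θ : Sub Sig Γ Δ) → Sub Sig (As ++ Γ) Δ
  | [], _, θ => θ
  | _ :: _, w, θ => Sub.cons (w _ .here) (Sub.append (fun A x => w A (.there x)) θ)

/-- Extend a substitution to one further variable, which stays fixed. -/
def Sub.lift {Sig : Type u} {Γ Δ : Ctx} (θ : Sub Sig Γ Δ) (B : Ty) :
    Sub Sig (B :: Γ) (B :: Δ) :=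
  Sub.cons (.var .here) (fun A x => (θ A x).rename (fun _ y => .there y))

/-- Extend a substitution to a list of further variables, which stay fixed. -/
def Sub.lifts {Sig : Type u} {Γ Δ : Ctx} (θ : Sub Sig Γ Δ) :
    (As : List Ty) → Sub Sig (As ++ Γ) (As ++ Δ)
  | [] => θ
  | B :: As => (Sub.lifts θ As).lift B

/-- Capture-avoiding simultaneous substitution. -/
def Tm.subst {Sig : Type u} : {Γ : Ctx} → {K : Kind} → Tm Sig Γ K →
    {Δ : Ctx} → Sub Sig Γ Δ → Tm Sig Δ K
  | _, _, .var x, _, θ => θ _ x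
  | _, _, .zero, _, _ => .zero
  | _, _, .succ v, _, θ => .succ (v.subst θ)
  | _, _, .star, _, _ => .star
  | _, _, .lam As t, _, θ => .lam As (t.subst (θ.lifts As))
  | _, _, .app v w, _, θ => .app (v.subst θ) (fun A x => (w A x).subst θ)
  | _, _, .mu v w, _, θ => .mu (v.subst (θ.lift _)) (fun A x => (w A x).subst θ)
  | _, _, .op σ v t, _, θ => .op σ (v.subst θ) (t.subst (θ.lift _))
  | _, _, .halt, _, _ => .halt
  | _, _, .case v s t, _, θ => .case (v.subst θ) (s.subst θ) (t.subst (θ.lift _))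

/-- `t[v/x]`, where `x` is the first variable. -/
def Tm.inst {Sig : Type u} {Γ : Ctx} {K : Kind} {B : Ty} (t : Tm Sig (B :: Γ) K)
    (v : Val Sig Γ B) : Tm Sig Γ K :=
  t.subst (Sub.cons v Sub.id)

/-- `t[w₁/x₁,…,wₙ/xₙ]`, where `x₁,…,xₙ` are the first variables. -/
def Tm.insts {Sig : Type u} {Γ : Ctx} {K : Kind} {As : List Ty} (t : Tm Sig (As ++ Γ) K)
    (w : Sub Sig As Γ) : Tm Sig Γ K :=
  t.subst (Sub.append w Sub.id)

/-! ## Operational semantics -/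

/-- The function `λ(y₁,…,yₙ):(A₁,…,Aₙ). (μx.v)(y₁,…,yₙ)`. -/
def unroll {Sig : Type u} {Γ : Ctx} {As : List Ty}
    (v : Val Sig (.neg As :: Γ) (.neg As)) : Val Sig Γ (.neg As) :=
  .lam As (.mu (v.rename ((Ren.inr As).lift _)) (fun A x => .var (Ren.inl As A x)))

/-- The reduction relation `⟶` on closed computations. -/
inductive Red {Sig : Type u} : Comp Sig [] → Comp Sig [] → Prop
  | beta {As : List Ty} (t : Comp Sig (As ++ [])) (w : Sub Sig As []) :
      Red (.app (.lam As t) w) (t.insts w)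
  | mu {As : List Ty} (v : Val Sig [.neg As] (.neg As)) (w : Sub Sig As []) :
      Red (.mu v w) (.app (v.inst (unroll v)) w)
  | case_zero (s : Comp Sig []) (t : Comp Sig [.nat]) : Red (.case .zero s t) s
  | case_succ (v : Val Sig [] .nat) (s : Comp Sig []) (t : Comp Sig [.nat]) :
      Red (.case (.succ v) s t) (t.inst v)

/-- The effect transitions `σ(v, x.t) ⟶ (t[n/x])ₙ`, labelled by `σ` and the numeral `v`. -/
inductive Eff {Sig : Type u} : Comp Sig [] → Sig → ℕ → (ℕ → Comp Sig []) → Prop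
  | op (σ : Sig) (m : ℕ) (t : Comp Sig [.nat]) :
      Eff (.op σ (num m) t) σ m (fun n => t.inst (num n))

/-- The number denoted by a term of the form `succⁿ(zero)`; by `num_toNat`, every closed value of
type `nat` has that form. (Other terms get the default value `0` for their innermost part.) -/
def toNat {Sig : Type u} : {Γ : Ctx} → {K : Kind} → Tm Sig Γ K → ℕ
  | _, _, .succ v => toNat v + 1
  | _, _, _ => 0

/-- What a closed computation does next: it reduces, performs an effect, or terminates. -/
inductive Outcome (Sig : Type u) : Type u
  | next (s : Comp Sig []) : Outcome Sig
  | effect (σ : Sig) (m : ℕ) (k : ℕ → Comp Sig []) : Outcome Sig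
  | halted : Outcome Sig

/-- The transitions of closed computations, as a function. By `step_eq_next_iff`,
`step_eq_effect_iff` and `step_eq_halted_iff` it is the graph of `⟶` and of the effect transitions,
and only `↓` has no transition. -/
def step {Sig : Type u} : Comp Sig [] → Outcome Sig
  | .app (.lam _ t) w => .next (t.insts w)
  | .app (.var x) _ => nomatch x
  | .mu v w => .next (.app (v.inst (unroll v)) w)
  | .op σ v t => .effect σ (toNat v) (fun n => t.inst (num n))
  | .halt => .halted
  | .case .zero s _ => .next s
  | .case (.succ v) _ t => .next (t.inst v)
  | .case (.var x) _ _ => nomatch x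

theorem num_toNat {Sig : Type u} : (v : Val Sig [] .nat) → num (toNat v) = v
  | .zero => rfl
  | .succ v => congrArg Tm.succ (num_toNat v)
  | .var x => nomatch x

theorem toNat_num {Sig : Type u} (n : ℕ) : toNat (num n : Val Sig [] .nat) = n := by
  induction n with
  | zero => rfl
  | succ n ih => exact congrArg Nat.succ ih

theorem step_eq_next_iff {Sig : Type u} (t s : Comp Sig []) : step t = .next s ↔ Red t s := by
  constructor
  · intro h
    match t, h with
    | .app (.lam _ t) w, h => cases h; exact .beta t w
    | .app (.var x) _, _ => nomatch x
    | .mu v w, h => cases h; exact .mu v w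
    | .case .zero s t, h => cases h; exact .case_zero s t
    | .case (.succ v) s t, h => cases h; exact .case_succ v s t
    | .case (.var x) _ _, _ => nomatch x
  · intro h
    cases h <;> rfl

theorem step_eq_effect_iff {Sig : Type u} (t : Comp Sig []) (σ : Sig) (m : ℕ)
    (k : ℕ → Comp Sig []) : step t = .effect σ m k ↔ Eff t σ m k := by
  constructor
  · intro h
    match t, h with
    | .app (.var x) _, _ => nomatch x
    | .case (.var x) _ _, _ => nomatch x
    | .op σ v t, h =>
      cases h
      have h := Eff.op σ (toNat v) t
      rwa [num_toNat] at h
  · intro h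
    cases h
    simp only [step, toNat_num]

theorem step_eq_halted_iff {Sig : Type u} (t : Comp Sig []) : step t = .halted ↔ t = .halt := by
  constructor
  · intro h
    match t, h with
    | .app (.var x) _, _ => nomatch x
    | .case (.var x) _ _, _ => nomatch x
    | .halt, _ => rfl
  · rintro rfl
    rfl

/-! ## Effect trees -/

/-- Labels of the nodes of an effect tree: `⊥`, `↓` or `σₙ`. -/
inductive Label (Sig : Type u) : Type u
  | bot : Label Sig
  | halt : Label Sig
  | op (σ : Sig) (n : ℕ) : Label Sig

/-- Possibly infinite effect trees. A node is addressed by the list of the numbers of the children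
that lead to it from the root. A node labelled `σₙ` has one child for each natural number, a node
labelled `⊥` or `↓` is a leaf. Addresses below a leaf do not belong to the tree, and `label` has
the default value `⊥` there. -/
@[ext] structure Tree (Sig : Type u) : Type u where
  label : List ℕ → Label Sig
  below_leaf : ∀ p k, (∀ σ n, label p ≠ .op σ n) → label (p ++ [k]) = .bot

/-- The leaf `⊥`. -/
def Tree.bot {Sig : Type u} : Tree Sig where
  label _ := .bot
  below_leaf _ _ _ := rfl

/-- The leaf `↓`. -/
def Tree.halt {Sig : Type u} : Tree Sig where
  label
    | [] => .halt
    | _ :: _ => .bot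
  below_leaf p k _ := by cases p <;> rfl

/-- The tree `σₙ(tr₀, tr₁, …)`. -/
def Tree.op {Sig : Type u} (σ : Sig) (n : ℕ) (tr : ℕ → Tree Sig) : Tree Sig where
  label
    | [] => .op σ n
    | k :: p => (tr k).label p
  below_leaf p k h := by
    cases p with
    | nil => exact absurd rfl (h σ n)
    | cons j p => exact (tr j).below_leaf p k h

/-- `a ≤ b` if `a` is obtained by replacing subtrees of `b` by `⊥`. -/
instance {Sig : Type u} : PartialOrder (Tree Sig) where
  le a b := ∀ p, a.label p = .bot ∨ a.label p = b.label p
  le_refl _ _ := Or.inr rfl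
  le_trans a b c hab hbc p := by
    rcases hab p with h | h
    · exact Or.inl h
    · rcases hbc p with h' | h'
      · exact Or.inl (h.trans h')
      · exact Or.inr (h.trans h')
  le_antisymm a b hab hba := by
    ext p
    rcases hab p with h | h
    · rcases hba p with h' | h'
      · exact h.trans h'.symm
      · exact h'.symm
    · exact h

open Classical in
/-- Labels of the least upper bound of a chain. -/
noncomputable def supLabel {Sig : Type u} (c : ℕ → Tree Sig) (p : List ℕ) : Label Sig :=
  if h : ∃ n, (c n).label p ≠ .bot then (c h.choose).label p else .bot

theorem supLabel_eq {Sig : Type u} (c : ℕ → Tree Sig) (hc : Monotone c) (p : List ℕ)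
    (n : ℕ) (hn : (c n).label p ≠ .bot) : supLabel c p = (c n).label p := by
  have h : ∃ n, (c n).label p ≠ .bot := ⟨n, hn⟩
  rw [supLabel, dif_pos h]
  rcases le_total n h.choose with hle | hle
  · exact ((hc hle p).resolve_left hn).symm
  · exact (hc hle p).resolve_left h.choose_spec

theorem supLabel_eq_bot {Sig : Type u} (c : ℕ → Tree Sig) (p : List ℕ)
    (h : ∀ n, (c n).label p = .bot) : supLabel c p = .bot := by
  rw [supLabel, dif_neg]
  rintro ⟨n, hn⟩
  exact hn (h n)

/-- Effect trees form an `ω`-CPO. -/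
noncomputable instance {Sig : Type u} : OmegaCompletePartialOrder (Tree Sig) where
  ωSup c :=
    { label := supLabel c
      below_leaf := by
        intro p k hp
        apply supLabel_eq_bot
        intro n
        by_contra hn
        apply hn
        apply (c n).below_leaf
        intro σ m hm
        have h : (c n).label p ≠ .bot := by rw [hm]; exact nofun
        exact hp σ m ((supLabel_eq c (OrderHomClass.mono c) p n h).trans hm) }
  le_ωSup c n p := by
    by_cases h : (c n).label p = .bot
    · exact Or.inl h
    · exact Or.inr (supLabel_eq c (OrderHomClass.mono c) p n h).symm
  ωSup_le c x hx p := by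
    by_cases h : ∃ n, (c n).label p ≠ .bot
    · obtain ⟨n, hn⟩ := h
      right
      exact (supLabel_eq c (OrderHomClass.mono c) p n hn).trans ((hx n p).resolve_left hn)
    · left
      refine supLabel_eq_bot c p (fun n => ?_)
      by_contra hn
      exact h ⟨n, hn⟩

/-- The tree `⟦t⟧ₙ` of the first `n` steps of the evaluation of `t`. -/
def approx {Sig : Type u} : ℕ → Comp Sig [] → Tree Sig
  | 0, _ => .bot
  | n + 1, t =>
    match step t with
    | .next s => approx n s
    | .effect σ m k => .op σ m (fun i => approx n (k i))
    | .halted => .halt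

theorem approx_le_succ {Sig : Type u} (n : ℕ) (t : Comp Sig []) :
    approx n t ≤ approx (n + 1) t := by
  induction n generalizing t with
  | zero => exact fun _ => Or.inl rfl
  | succ n ih =>
    rw [approx, approx]
    cases step t with
    | next s => exact ih s
    | effect σ m k =>
      intro p
      cases p with
      | nil => exact Or.inr rfl
      | cons j p => exact ih (k j) p
    | halted => exact le_refl _

/-- The effect tree `⟦t⟧` of a closed computation, the least upper bound of the `⟦t⟧ₙ`. -/
noncomputable def tree {Sig : Type u} (t : Comp Sig []) : Tree Sig :=
  OmegaCompletePartialOrder.ωSup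
    ⟨⟨fun n => approx n t, monotone_nat_of_le_succ (fun n => approx_le_succ n t)⟩⟩

/-! ## Observations -/

/-- Scott-open sets of trees. -/
def ScottOpen {Sig : Type u} (X : Set (Tree Sig)) : Prop :=
  (∀ a b, a ∈ X → a ≤ b → b ∈ X) ∧
    ∀ (c : ℕ → Tree Sig) (l : Tree Sig), Monotone c → IsLUB (Set.range c) l → l ∈ X →
      ∃ j, c j ∈ X

/-- Decomposable sets of observations. -/
def Decomposable {Sig : Type u} (𝔓 : Set (Set (Tree Sig))) : Prop :=
  ∀ P ∈ 𝔓, ∀ (σ : Sig) (n : ℕ) (tr : ℕ → Tree Sig), Tree.op σ n tr ∈ P →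
    ∃ P' : ℕ → Set (Tree Sig), (∀ k, P' k ∈ 𝔓) ∧ (∀ k, tr k ∈ P' k) ∧
      ∀ p' : ℕ → Tree Sig, (∀ k, p' k ∈ P' k) → Tree.op σ n p' ∈ P

/-- Consistent sets of observations. -/
def Consistent {Sig : Type u} (𝔓 : Set (Set (Tree Sig))) : Prop :=
  ∃ P₀ ∈ 𝔓, P₀ ≠ Set.univ ∧ ∃ t₀ : Comp Sig [], tree t₀ ∈ P₀

/-! ## Relations on terms -/

/-- Well-typed relations on closed terms. -/
abbrev ClosedRel (Sig : Type u) : Type u := ∀ K : Kind, Tm Sig [] K → Tm Sig [] K → Prop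

/-- Well-typed relations on possibly open terms. -/
abbrev OpenRel (Sig : Type u) : Type u :=
  ∀ (Γ : Ctx) (K : Kind), Tm Sig Γ K → Tm Sig Γ K → Prop

/-- The open extension of a relation on closed terms. -/
def openExt {Sig : Type u} (R : ClosedRel Sig) : OpenRel Sig :=
  fun Γ K s t => ∀ θ : Sub Sig Γ [], R K (s.subst θ) (t.subst θ)

/-! ## Applicative bisimilarity -/

/-- Applicative `𝔓`-simulations. -/
structure IsSimulation {Sig : Type u} (𝔓 : Set (Set (Tree Sig))) (R : ClosedRel Sig) : Prop where
  unit : ∀ v w, R (.val .unit) v w → v = .star ∧ w = .star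
  nat : ∀ v w, R (.val .nat) v w → v = w
  comp : ∀ s t, R .comp s t → ∀ P ∈ 𝔓, tree s ∈ P → tree t ∈ P
  neg : ∀ (As : List Ty) v u, R (.val (.neg As)) v u →
    ∀ w : Sub Sig As [], R .comp (.app v w) (.app u w)

/-- Applicative `𝔓`-bisimulations are the symmetric simulations. -/
structure IsBisimulation {Sig : Type u} (𝔓 : Set (Set (Tree Sig))) (R : ClosedRel Sig) : Prop
    extends IsSimulation 𝔓 R where
  symm : ∀ K s t, R K s t → R K t s

/-- Applicative `𝔓`-bisimilarity, the union of all applicative `𝔓`-bisimulations. -/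
def bisimilarity {Sig : Type u} (𝔓 : Set (Set (Tree Sig))) : ClosedRel Sig :=
  fun K s t => ∃ R, IsBisimulation 𝔓 R ∧ R K s t

/-! ## The logic `𝓕` -/

/-- Value formulas of the logic `𝓕`, by type. Disjunctions and conjunctions are indexed by
arbitrary sets. -/
inductive Formula {Sig : Type u} (𝔓 : Set (Set (Tree Sig))) : Ty → Type (u + 1)
  /-- `{n} : nat` -/
  | single (n : ℕ) : Formula 𝔓 .nat
  /-- `(φ₁,…,φₙ) ↦ P : ¬(A₁,…,Aₙ)` -/
  | maps {As : List Ty} (φ : ∀ A, Var As A → Formula 𝔓 A) (P : Set (Tree Sig)) (hP : P ∈ 𝔓) :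
      Formula 𝔓 (.neg As)
  | disj {A : Ty} (I : Type u) (φ : I → Formula 𝔓 A) : Formula 𝔓 A
  | conj {A : Ty} (I : Type u) (φ : I → Formula 𝔓 A) : Formula 𝔓 A
  | not {A : Ty} (φ : Formula 𝔓 A) : Formula 𝔓 A

/-- The satisfaction relation `v ⊨ φ`. -/
def Formula.Sat {Sig : Type u} {𝔓 : Set (Set (Tree Sig))} :
    {A : Ty} → Formula 𝔓 A → Val Sig [] A → Prop
  | _, .single n, v => v = num n
  | _, .maps φ P _, v =>
    ∀ w : Sub Sig _ [], (∀ A x, (φ A x).Sat (w A x)) → tree (.app v w) ∈ P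
  | _, .disj _ φ, v => ∃ j, (φ j).Sat v
  | _, .conj _ φ, v => ∀ j, (φ j).Sat v
  | _, .not φ, v => ¬ φ.Sat v

/-- The formulas of the fragment `𝓕⁺`, in which no negation occurs. -/
def Formula.Positive {Sig : Type u} {𝔓 : Set (Set (Tree Sig))} :
    {A : Ty} → Formula 𝔓 A → Prop
  | _, .single _ => True
  | _, .maps φ _ _ => ∀ A x, (φ A x).Positive
  | _, .disj _ φ => ∀ j, (φ j).Positive
  | _, .conj _ φ => ∀ j, (φ j).Positive
  | _, .not _ => False

/-- The logical preorder of `𝓕`. The computation formulas are the elements of `𝔓`, and `t ⊨ P`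
means that the tree of `t` belongs to `P`. -/
def logPre {Sig : Type u} (𝔓 : Set (Set (Tree Sig))) : ClosedRel Sig
  | .val A, v, w => ∀ φ : Formula 𝔓 A, φ.Sat v → φ.Sat w
  | .comp, s, t => ∀ P ∈ 𝔓, tree s ∈ P → tree t ∈ P

/-- The logical preorder of `𝓕⁺`. -/
def logPrePos {Sig : Type u} (𝔓 : Set (Set (Tree Sig))) : ClosedRel Sig
  | .val A, v, w => ∀ φ : Formula 𝔓 A, φ.Positive → φ.Sat v → φ.Sat w
  | .comp, s, t => ∀ P ∈ 𝔓, tree s ∈ P → tree t ∈ P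

/-- `𝓕`-logical equivalence. -/
def logEquiv {Sig : Type u} (𝔓 : Set (Set (Tree Sig))) : ClosedRel Sig :=
  fun K s t => logPre 𝔓 K s t ∧ logPre 𝔓 K t s

/-! ## Contextual preorder and equivalence -/

/-- Compatible relations. -/
structure Compatible {Sig : Type u} (R : OpenRel Sig) : Prop where
  var : ∀ Γ A (x : Var Γ A), R Γ (.val A) (.var x) (.var x)
  star : ∀ Γ, R Γ (.val .unit) .star .star
  lam : ∀ Γ As (s t : Comp Sig (As ++ Γ)), R (As ++ Γ) .comp s t →
    R Γ (.val (.neg As)) (.lam As s) (.lam As t)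
  zero : ∀ Γ, R Γ (.val .nat) .zero .zero
  succ : ∀ Γ (v v' : Val Sig Γ .nat), R Γ (.val .nat) v v' → R Γ (.val .nat) (.succ v) (.succ v')
  app : ∀ Γ As (v v' : Val Sig Γ (.neg As)) (w w' : Sub Sig As Γ),
    R Γ (.val (.neg As)) v v' → (∀ A x, R Γ (.val A) (w A x) (w' A x)) →
    R Γ .comp (.app v w) (.app v' w')
  mu : ∀ Γ As (v v' : Val Sig (.neg As :: Γ) (.neg As)) (w w' : Sub Sig As Γ),
    R (.neg As :: Γ) (.val (.neg As)) v v' → (∀ A x, R Γ (.val A) (w A x) (w' A x)) →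
    R Γ .comp (.mu v w) (.mu v' w')
  op : ∀ Γ σ (v v' : Val Sig Γ .nat) (t t' : Comp Sig (.nat :: Γ)),
    R Γ (.val .nat) v v' → R (.nat :: Γ) .comp t t' → R Γ .comp (.op σ v t) (.op σ v' t')
  halt : ∀ Γ, R Γ .comp .halt .halt
  case : ∀ Γ (v v' : Val Sig Γ .nat) (s s' : Comp Sig Γ) (t t' : Comp Sig (.nat :: Γ)),
    R Γ (.val .nat) v v' → R Γ .comp s s' → R (.nat :: Γ) .comp t t' →
    R Γ .comp (.case v s t) (.case v' s' t')

/-- `𝔓`-adequate relations. -/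
def Adequate {Sig : Type u} (𝔓 : Set (Set (Tree Sig))) (R : OpenRel Sig) : Prop :=
  ∀ s t : Comp Sig [], R [] .comp s t → ∀ P ∈ 𝔓, tree s ∈ P → tree t ∈ P

/-- `𝔓`-biadequate relations. -/
def Biadequate {Sig : Type u} (𝔓 : Set (Set (Tree Sig))) (R : OpenRel Sig) : Prop :=
  ∀ s t : Comp Sig [], R [] .comp s t → ∀ P ∈ 𝔓, (tree s ∈ P ↔ tree t ∈ P)

/-- The contextual preorder, the union of all compatible and `𝔓`-adequate relations. -/
def ctxPre {Sig : Type u} (𝔓 : Set (Set (Tree Sig))) : OpenRel Sig :=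
  fun Γ K s t => ∃ R, Compatible R ∧ Adequate 𝔓 R ∧ R Γ K s t

/-- Contextual equivalence, the union of all compatible and `𝔓`-biadequate relations. -/
def ctxEquiv {Sig : Type u} (𝔓 : Set (Set (Tree Sig))) : OpenRel Sig :=
  fun Γ K s t => ∃ R, Compatible R ∧ Biadequate 𝔓 R ∧ R Γ K s t

end ECPS

namespace ECPS

/-! Every relation in the theorem is compared with applicative similarity. Computations return no
values, so similarity needs no coinduction: functions are similar when their applications to the
same closed arguments are observationally ordered. Bisimilarity is similarity in both directions
(`bisimilarity_iff`).

The crux is that the open extension of similarity is compatible. This is shown with a step-indexed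
logical relation in which the left term is observed for `n` steps and the right term in full. It is
compatible (`logRel_compatible`): decomposability handles effects, and recursion is handled by
induction on `n`, because unfolding consumes a step. Scott-openness recovers observations of whole
trees from finite approximations, and the logical relation turns out to equal the open extension of
similarity (`openExt_similarity`).

For the logics, similarity preserves positive formulas, and mutual similarity preserves negation
too. Conversely, each closed value `w` has a characteristic formula, satisfied only by values
logically above `w`. Such formulas test a function at essentially one tuple of arguments;
compatibility covers the other tuples that satisfy them (`similarity_of_formulas`).

For contexts, a compatible adequate relation survives closing substitutions of computations, by
β-reduction. It separates numerals by a context that runs the consistency witness at one numeral and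
diverges at all others (`Compatible.subst_nat_eq`). -/

variable {Sig : Type u} {𝔓 : Set (Set (Tree Sig))}

/-! ## Renaming and substitution -/

theorem Ren.lift_comp {Γ Δ Θ : Ctx} (ρ : Ren Γ Δ) (ρ' : Ren Δ Θ) (B : Ty) :
    Ren.lift (fun A x => ρ' A (ρ A x)) B = fun A x => ρ'.lift B A (ρ.lift B A x) := by
  funext A x
  cases x <;> rfl

theorem Ren.lifts_comp {Γ Δ Θ : Ctx} (ρ : Ren Γ Δ) (ρ' : Ren Δ Θ) (As : List Ty) :
    Ren.lifts (fun A x => ρ' A (ρ A x)) As = fun A x => ρ'.lifts As A (ρ.lifts As A x) := by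
  induction As with
  | nil => rfl
  | cons B As ih =>
    rw [Ren.lifts, ih, Ren.lift_comp]
    rfl

/-- First of four fusion laws. Their order is forced: `Sub.lift` itself renames, so moving it past a
renaming or a substitution needs the earlier laws. -/
theorem Tm.rename_rename {Γ Δ Θ : Ctx} {K : Kind} (t : Tm Sig Γ K) (ρ : Ren Γ Δ)
    (ρ' : Ren Δ Θ) : (t.rename ρ).rename ρ' = t.rename (fun A x => ρ' A (ρ A x)) := by
  induction t generalizing Δ Θ <;>
    simp_all only [Tm.rename, Ren.lift_comp, Ren.lifts_comp]

theorem Sub.lift_comp_ren {Γ Δ Θ : Ctx} (ρ : Ren Γ Δ) (θ : Sub Sig Δ Θ) (B : Ty) :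
    Sub.lift (fun A x => θ A (ρ A x)) B = fun A x => θ.lift B A (ρ.lift B A x) := by
  funext A x
  cases x <;> rfl

theorem Sub.lifts_comp_ren {Γ Δ Θ : Ctx} (ρ : Ren Γ Δ) (θ : Sub Sig Δ Θ) (As : List Ty) :
    Sub.lifts (fun A x => θ A (ρ A x)) As = fun A x => θ.lifts As A (ρ.lifts As A x) := by
  induction As with
  | nil => rfl
  | cons B As ih =>
    rw [Sub.lifts, ih, Sub.lift_comp_ren]
    rfl

theorem Tm.subst_rename {Γ Δ Θ : Ctx} {K : Kind} (t : Tm Sig Γ K) (ρ : Ren Γ Δ)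
    (θ : Sub Sig Δ Θ) : (t.rename ρ).subst θ = t.subst (fun A x => θ A (ρ A x)) := by
  induction t generalizing Δ Θ <;>
    simp_all only [Tm.rename, Tm.subst, Sub.lift_comp_ren, Sub.lifts_comp_ren]

theorem Sub.lift_rename {Γ Δ Θ : Ctx} (θ : Sub Sig Γ Δ) (ρ : Ren Δ Θ) (B : Ty) :
    Sub.lift (fun A x => (θ A x).rename ρ) B = fun A x => (θ.lift B A x).rename (ρ.lift B) := by
  funext A x
  cases x with
  | here => rfl
  | there x =>
    simp only [Sub.lift, Sub.cons, Tm.rename_rename]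
    rfl

theorem Sub.lifts_rename {Γ Δ Θ : Ctx} (θ : Sub Sig Γ Δ) (ρ : Ren Δ Θ) (As : List Ty) :
    Sub.lifts (fun A x => (θ A x).rename ρ) As =
      fun A x => (θ.lifts As A x).rename (ρ.lifts As) := by
  induction As with
  | nil => rfl
  | cons B As ih =>
    rw [Sub.lifts, ih, Sub.lift_rename]
    rfl

theorem Tm.rename_subst {Γ Δ Θ : Ctx} {K : Kind} (t : Tm Sig Γ K) (θ : Sub Sig Γ Δ)
    (ρ : Ren Δ Θ) : (t.subst θ).rename ρ = t.subst (fun A x => (θ A x).rename ρ) := by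
  induction t generalizing Δ Θ <;>
    simp_all only [Tm.rename, Tm.subst, Sub.lift_rename, Sub.lifts_rename]

theorem Sub.lift_comp {Γ Δ Θ : Ctx} (θ : Sub Sig Γ Δ) (η : Sub Sig Δ Θ) (B : Ty) :
    Sub.lift (fun A x => (θ A x).subst η) B = fun A x => (θ.lift B A x).subst (η.lift B) := by
  funext A x
  cases x with
  | here => rfl
  | there x =>
    simp only [Sub.lift, Sub.cons, Tm.rename_subst, Tm.subst_rename]

theorem Sub.lifts_comp {Γ Δ Θ : Ctx} (θ : Sub Sig Γ Δ) (η : Sub Sig Δ Θ) (As : List Ty) :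
    Sub.lifts (fun A x => (θ A x).subst η) As =
      fun A x => (θ.lifts As A x).subst (η.lifts As) := by
  induction As with
  | nil => rfl
  | cons B As ih =>
    rw [Sub.lifts, ih, Sub.lift_comp]
    rfl

theorem Tm.subst_subst {Γ Δ Θ : Ctx} {K : Kind} (t : Tm Sig Γ K) (θ : Sub Sig Γ Δ)
    (η : Sub Sig Δ Θ) : (t.subst θ).subst η = t.subst (fun A x => (θ A x).subst η) := by
  induction t generalizing Δ Θ <;>
    simp_all only [Tm.subst, Sub.lift_comp, Sub.lifts_comp]

theorem Sub.lift_id {Γ : Ctx} (B : Ty) : (Sub.id : Sub Sig Γ Γ).lift B = Sub.id := by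
  funext A x
  cases x <;> rfl

theorem Sub.lifts_id {Γ : Ctx} (As : List Ty) : (Sub.id : Sub Sig Γ Γ).lifts As = Sub.id := by
  induction As with
  | nil => rfl
  | cons B As ih =>
    rw [Sub.lifts, ih, Sub.lift_id]

theorem Tm.subst_id {Γ : Ctx} {K : Kind} (t : Tm Sig Γ K) : t.subst Sub.id = t := by
  induction t <;> simp_all only [Tm.subst, Sub.lift_id, Sub.lifts_id, Sub.id]

theorem Tm.subst_closed {K : Kind} (t : Tm Sig [] K) (θ : Sub Sig [] []) : t.subst θ = t := by
  have h : θ = Sub.id := by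
    funext A x
    cases x
  rw [h, Tm.subst_id]

theorem Tm.subst_rename_closed {Γ : Ctx} {K : Kind} (t : Tm Sig [] K) (ρ : Ren [] Γ)
    (θ : Sub Sig Γ []) : (t.rename ρ).subst θ = t := by
  rw [Tm.subst_rename, Tm.subst_closed]

/-- Brings the reduct of a substituted redex into the form of a single substitution, to which
hypotheses about open terms apply. -/
theorem Tm.inst_subst_lift {Γ Δ : Ctx} {K : Kind} {B : Ty} (t : Tm Sig (B :: Γ) K)
    (θ : Sub Sig Γ Δ) (v : Val Sig Δ B) :
    (t.subst (θ.lift B)).inst v = t.subst (Sub.cons v θ) := by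
  rw [Tm.inst, Tm.subst_subst]
  congr 1
  funext A x
  cases x with
  | here => rfl
  | there x =>
    simp only [Sub.lift, Sub.cons, Tm.subst_rename]
    exact Tm.subst_id _

theorem Sub.append_inl {Γ Δ : Ctx} {As : List Ty} (w : Sub Sig As Δ) (θ : Sub Sig Γ Δ) {A : Ty}
    (x : Var As A) : Sub.append w θ A (Ren.inl As A x) = w A x := by
  induction x with
  | here => rfl
  | there x ih => exact ih (fun A y => w A (.there y))

theorem Sub.append_subst_lifts {Γ Δ : Ctx} {As : List Ty} (w : Sub Sig As Δ) (θ : Sub Sig Γ Δ)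
    {A : Ty} (x : Var (As ++ Γ) A) :
    (θ.lifts As A x).subst (Sub.append w Sub.id) = Sub.append w θ A x := by
  induction As with
  | nil => exact Tm.subst_id _
  | cons B As ih =>
    cases x with
    | here => rfl
    | there x =>
      have h := ih (fun A y => w A (.there y)) x
      simp only [Sub.lifts, Sub.lift, Sub.cons, Tm.subst_rename]
      exact h

theorem Tm.insts_subst_lifts {Γ Δ : Ctx} {K : Kind} {As : List Ty} (t : Tm Sig (As ++ Γ) K)
    (θ : Sub Sig Γ Δ) (w : Sub Sig As Δ) :
    (t.subst (θ.lifts As)).insts w = t.subst (Sub.append w θ) := by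
  rw [Tm.insts, Tm.subst_subst]
  congr 1
  funext A x
  exact Sub.append_subst_lifts w θ x

/-- The body of `unroll v`, instantiated by `w`, is `(μx.v)(w)`. -/
theorem insts_unroll {As : List Ty} (v : Val Sig [.neg As] (.neg As)) (w : Sub Sig As []) :
    (Tm.mu (v.rename ((Ren.inr As).lift _)) (fun A x => .var (Ren.inl As A x))).insts w =
      .mu v w := by
  simp only [Tm.insts, Tm.subst, Tm.subst_rename, Sub.append_inl]
  congr 1
  -- The recursion variable is the only variable of `v` and stays fixed, so the composite
  -- substitution is the identity.
  conv_rhs => rw [← Tm.subst_id v]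
  congr 1
  funext A x
  rcases x with _ | x
  · rfl
  · cases x

/-! ## Effect trees -/

theorem approx_mono (t : Comp Sig []) : Monotone (fun n => approx n t) :=
  monotone_nat_of_le_succ (fun n => approx_le_succ n t)

theorem approx_le_tree (n : ℕ) (t : Comp Sig []) : approx n t ≤ tree t :=
  OmegaCompletePartialOrder.le_ωSup ⟨⟨fun n => approx n t, approx_mono t⟩⟩ n

theorem tree_le {t : Comp Sig []} {a : Tree Sig} (h : ∀ n, approx n t ≤ a) : tree t ≤ a :=
  OmegaCompletePartialOrder.ωSup_le _ _ h

theorem Tree.bot_le (a : Tree Sig) : Tree.bot ≤ a := fun _ => Or.inl rfl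

theorem approx_succ_of_red {s t : Comp Sig []} (h : Red t s) (n : ℕ) :
    approx (n + 1) t = approx n s := by
  rw [approx, (step_eq_next_iff t s).2 h]

theorem approx_le_of_red {s t : Comp Sig []} (h : Red t s) (n : ℕ) : approx n t ≤ approx n s := by
  cases n with
  | zero => exact Tree.bot_le _
  | succ n =>
    rw [approx_succ_of_red h]
    exact approx_le_succ n s

theorem tree_eq_of_red {s t : Comp Sig []} (h : Red t s) : tree t = tree s := by
  apply le_antisymm
  · exact tree_le fun n => (approx_le_of_red h n).trans (approx_le_tree n s)
  · refine tree_le fun n => ?_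
    rw [← approx_succ_of_red h]
    exact approx_le_tree _ t

theorem approx_succ_of_eff {t : Comp Sig []} {σ : Sig} {m : ℕ} {k : ℕ → Comp Sig []}
    (h : Eff t σ m k) (n : ℕ) : approx (n + 1) t = Tree.op σ m (fun i => approx n (k i)) := by
  rw [approx, (step_eq_effect_iff t σ m k).2 h]

/-- A label that appears in a child at stage `n` appears in `t` at stage `n + 1`. This inequality
suffices because observations are upward closed. -/
theorem op_le_tree {t : Comp Sig []} {σ : Sig} {m : ℕ} {k : ℕ → Comp Sig []}
    (h : Eff t σ m k) : Tree.op σ m (fun i => tree (k i)) ≤ tree t := by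
  intro p
  cases p with
  | nil =>
    have h1 := approx_le_tree 1 t []
    rw [approx_succ_of_eff h] at h1
    exact h1
  | cons i p =>
    by_cases hn : ∃ n, (approx n (k i)).label p ≠ .bot
    · obtain ⟨n, hn⟩ := hn
      right
      have h1 := approx_le_tree (n + 1) t (i :: p)
      rw [approx_succ_of_eff h] at h1
      exact ((approx_le_tree n (k i) p).resolve_left hn).symm.trans (h1.resolve_left hn)
    · left
      push Not at hn
      exact supLabel_eq_bot _ p hn

/-- A Scott-open set that contains the tree of `t` contains one of its approximations. -/
theorem ScottOpen.exists_approx {P : Set (Tree Sig)} (hP : ScottOpen P) {t : Comp Sig []}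
    (h : tree t ∈ P) : ∃ n, approx n t ∈ P := by
  refine hP.2 (fun n => approx n t) (tree t) (approx_mono t) ⟨?_, ?_⟩ h
  · rintro _ ⟨n, rfl⟩
    exact approx_le_tree n t
  · exact fun a ha => tree_le fun n => ha ⟨n, rfl⟩

/-! ## Applicative similarity -/

/-- The observational preorder on closed computations. -/
def obsPre (𝔓 : Set (Set (Tree Sig))) (s t : Comp Sig []) : Prop :=
  ∀ P ∈ 𝔓, tree s ∈ P → tree t ∈ P

/-- Applicative `𝔓`-similarity. As computations do not return values, it is given explicitly. -/
def similarity (𝔓 : Set (Set (Tree Sig))) : ClosedRel Sig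
  | .val .unit, _, _ => True
  | .val .nat, v, u => v = u
  | .val (.neg As), v, u => ∀ w : Sub Sig As [], obsPre 𝔓 (.app v w) (.app u w)
  | .comp, s, t => obsPre 𝔓 s t

theorem eq_star : (v : Val Sig [] .unit) → v = .star
  | .star => rfl
  | .var x => nomatch x

theorem IsSimulation.le_similarity {R : ClosedRel Sig} (hR : IsSimulation 𝔓 R) {K : Kind}
    {s t : Tm Sig [] K} (h : R K s t) : similarity 𝔓 K s t := by
  match K, s, t, h with
  | .val .unit, _, _, _ => trivial
  | .val .nat, v, u, h => exact hR.nat v u h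
  | .val (.neg As), v, u, h => exact fun w => hR.comp _ _ (hR.neg As v u h w)
  | .comp, s, t, h => exact hR.comp s t h

/-- Mutual similarity is itself a bisimulation: the clause for functions leads straight to
computations, where only the observations remain to be compared. -/
theorem bisimilarity_iff (K : Kind) (s t : Tm Sig [] K) :
    bisimilarity 𝔓 K s t ↔ similarity 𝔓 K s t ∧ similarity 𝔓 K t s := by
  constructor
  · rintro ⟨R, hR, h⟩
    exact ⟨hR.le_similarity h, hR.le_similarity (hR.symm _ _ _ h)⟩
  · intro h
    refine ⟨fun K s t => similarity 𝔓 K s t ∧ similarity 𝔓 K t s, ?_, h⟩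
    exact
      { unit := fun v w _ => ⟨eq_star v, eq_star w⟩
        nat := fun v w h => h.1
        comp := fun s t h => h.1
        neg := fun As v u h w => ⟨h.1 w, h.2 w⟩
        symm := fun K s t h => h.symm }

/-! ## The step-indexed logical relation -/

/-- Termination measure for recursion from `neg As` to its argument types. -/
theorem Var.sizeOf_lt {As : List Ty} {A : Ty} (x : Var As A) : sizeOf A < sizeOf As := by
  induction x with
  | here => simp only [List.cons.sizeOf_spec]; omega
  | there x ih => simp only [List.cons.sizeOf_spec]; omega

/-- `s` observed for `n` steps is below `t`. -/
def obsPreStep (𝔓 : Set (Set (Tree Sig))) (n : ℕ) (s t : Comp Sig []) : Prop :=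
  ∀ P ∈ 𝔓, approx n s ∈ P → tree t ∈ P

/-- The step-indexed logical relation on closed values. -/
def valRel (𝔓 : Set (Set (Tree Sig))) : (A : Ty) → ℕ → Val Sig [] A → Val Sig [] A → Prop
  | .unit, _, _, _ => True
  | .nat, _, v, u => v = u
  | .neg As, n, v, u => ∀ m ≤ n, ∀ w w' : Sub Sig As [],
      (∀ A (x : Var As A), valRel 𝔓 A m (w A x) (w' A x)) →
        obsPreStep 𝔓 m (.app v w) (.app u w')
termination_by A => sizeOf A
decreasing_by
  have := x.sizeOf_lt
  simp only [Ty.neg.sizeOf_spec]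
  omega

/-- The step-indexed logical relation on closed terms. -/
def stepRel (𝔓 : Set (Set (Tree Sig))) (n : ℕ) : ClosedRel Sig
  | .val A, v, u => valRel 𝔓 A n v u
  | .comp, s, t => obsPreStep 𝔓 n s t

/-- The logical relation on closed substitutions. -/
def subRel (𝔓 : Set (Set (Tree Sig))) (n : ℕ) {Γ : Ctx} (θ η : Sub Sig Γ []) : Prop :=
  ∀ A x, valRel 𝔓 A n (θ A x) (η A x)

/-- The logical relation on open terms. -/
def logRel (𝔓 : Set (Set (Tree Sig))) : OpenRel Sig :=
  fun Γ K s t => ∀ n (θ η : Sub Sig Γ []), subRel 𝔓 n θ η →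
    stepRel 𝔓 n K (s.subst θ) (t.subst η)

theorem valRel_nat {n : ℕ} {v u : Val Sig [] .nat} : valRel 𝔓 .nat n v u ↔ v = u := by
  rw [valRel]

theorem valRel_neg {As : List Ty} {n : ℕ} {v u : Val Sig [] (.neg As)} :
    valRel 𝔓 (.neg As) n v u ↔ ∀ m ≤ n, ∀ w w' : Sub Sig As [], subRel 𝔓 m w w' →
      obsPreStep 𝔓 m (.app v w) (.app u w') := by
  rw [valRel]
  rfl

/-- Built into the function clause by its quantifier `∀ m ≤ n`; arguments occur contravariantly, so
a clause at `n` alone would not give it. -/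
theorem valRel_mono {A : Ty} {m n : ℕ} (hmn : m ≤ n) {v u : Val Sig [] A}
    (h : valRel 𝔓 A n v u) : valRel 𝔓 A m v u := by
  cases A with
  | unit => rw [valRel]; trivial
  | nat => rwa [valRel_nat] at h ⊢
  | neg As =>
    rw [valRel_neg] at h ⊢
    exact fun k hk => h k (hk.trans hmn)

theorem subRel.mono {Γ : Ctx} {m n : ℕ} (hmn : m ≤ n) {θ η : Sub Sig Γ []}
    (h : subRel 𝔓 n θ η) : subRel 𝔓 m θ η :=
  fun A x => valRel_mono hmn (h A x)

theorem subRel.cons {Γ : Ctx} {n : ℕ} {B : Ty} {v u : Val Sig [] B} {θ η : Sub Sig Γ []}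
    (hv : valRel 𝔓 B n v u) (h : subRel 𝔓 n θ η) : subRel 𝔓 n (Sub.cons v θ) (Sub.cons u η) := by
  intro A x
  cases x with
  | here => exact hv
  | there x => exact h A x

theorem subRel.append {Γ : Ctx} {n : ℕ} {As : List Ty} {w w' : Sub Sig As []}
    {θ η : Sub Sig Γ []} (hw : subRel 𝔓 n w w') (h : subRel 𝔓 n θ η) :
    subRel 𝔓 n (Sub.append w θ) (Sub.append w' η) := by
  induction As with
  | nil => exact h
  | cons B As ih => exact subRel.cons (hw _ .here) (ih fun A x => hw A (.there x))

theorem obsPreStep_mono (h_open : ∀ P ∈ 𝔓, ScottOpen P) {m n : ℕ} (hmn : m ≤ n)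
    {s t : Comp Sig []} (h : obsPreStep 𝔓 n s t) : obsPreStep 𝔓 m s t :=
  fun P hP hs => h P hP ((h_open P hP).1 _ _ hs (approx_mono s hmn))

theorem obsPreStep_of_red (h_open : ∀ P ∈ 𝔓, ScottOpen P) {n : ℕ} {s s' t t' : Comp Sig []}
    (hs : Red s s') (ht : Red t t') (h : obsPreStep 𝔓 n s' t') : obsPreStep 𝔓 n s t := by
  intro P hP hsP
  rw [tree_eq_of_red ht]
  exact h P hP ((h_open P hP).1 _ _ hsP (approx_le_of_red hs n))

/-- Counting the reduction on the left gains one index, which drives the induction for recursive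
functions. -/
theorem obsPreStep_succ_of_red {n : ℕ} {s s' t t' : Comp Sig []}
    (hs : Red s s') (ht : Red t t') (h : obsPreStep 𝔓 n s' t') : obsPreStep 𝔓 (n + 1) s t := by
  intro P hP hsP
  rw [tree_eq_of_red ht]
  rw [approx_succ_of_red hs] at hsP
  exact h P hP hsP

theorem obsPreStep_refl (h_open : ∀ P ∈ 𝔓, ScottOpen P) (n : ℕ) (t : Comp Sig []) :
    obsPreStep 𝔓 n t t :=
  fun P hP h => (h_open P hP).1 _ _ h (approx_le_tree n t)

theorem obsPreStep_zero (h_open : ∀ P ∈ 𝔓, ScottOpen P) (s t : Comp Sig []) :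
    obsPreStep 𝔓 0 s t :=
  fun P hP h => (h_open P hP).1 _ _ h (Tree.bot_le _)

theorem obsPre_iff (h_open : ∀ P ∈ 𝔓, ScottOpen P) {s t : Comp Sig []} :
    obsPre 𝔓 s t ↔ ∀ n, obsPreStep 𝔓 n s t := by
  constructor
  · exact fun h n P hP hs => h P hP ((h_open P hP).1 _ _ hs (approx_le_tree n s))
  · intro h P hP hs
    obtain ⟨n, hn⟩ := (h_open P hP).exists_approx hs
    exact h n P hP hn

/-- Decomposability splits an observation of the node into observations of its children; these are
transferred one by one and then reassembled. -/
theorem obsPreStep_op (h_decomp : Decomposable 𝔓) (h_open : ∀ P ∈ 𝔓, ScottOpen P) {n : ℕ}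
    {s t : Comp Sig []} {σ : Sig} {m : ℕ} {k l : ℕ → Comp Sig []} (hs : Eff s σ m k)
    (ht : Eff t σ m l) (h : ∀ i, obsPreStep 𝔓 n (k i) (l i)) : obsPreStep 𝔓 n s t := by
  cases n with
  | zero => exact obsPreStep_zero h_open s t
  | succ n =>
    intro P hP hsP
    rw [approx_succ_of_eff hs] at hsP
    obtain ⟨P', hP', hk, hop⟩ := h_decomp P hP σ m _ hsP
    exact (h_open P hP).1 _ _
      (hop _ fun i => obsPreStep_mono h_open n.le_succ (h i) _ (hP' i) (hk i)) (op_le_tree ht)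

/-- The recursive functions defined by related bodies are related. -/
theorem obsPreStep_mu (h_open : ∀ P ∈ 𝔓, ScottOpen P) {As : List Ty} {N : ℕ}
    {v v' : Val Sig [.neg As] (.neg As)}
    (hv : ∀ n ≤ N, ∀ u u', valRel 𝔓 (.neg As) n u u' →
      valRel 𝔓 (.neg As) n (v.inst u) (v'.inst u'))
    (w w' : Sub Sig As []) (hw : subRel 𝔓 N w w') :
    obsPreStep 𝔓 N (.mu v w) (.mu v' w') := by
  induction N using Nat.strong_induction_on generalizing w w' with
  | _ n ih =>
    cases n with
    | zero => exact obsPreStep_zero h_open _ _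
    | succ n =>
      refine obsPreStep_succ_of_red (.mu v w) (.mu v' w') ?_
      -- Unfolding has consumed a step, so the unrolled functions need only be related at `n`. Their
      -- bodies reduce the question to the original recursive calls at some `m ≤ n`, where the
      -- induction hypothesis applies.
      refine valRel_neg.1 (hv n n.le_succ _ _ (valRel_neg.2 ?_)) n le_rfl w w' (hw.mono n.le_succ)
      intro m hm z z' hz
      refine obsPreStep_of_red h_open (.beta _ z) (.beta _ z') ?_
      rw [insts_unroll, insts_unroll]
      have hm := Nat.lt_succ_of_le hm
      exact ih m hm (fun k hk => hv k (hk.trans hm.le)) z z' hz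

/-- The fundamental lemma of the logical relation. In the cases of `op` and `case`, related numbers
are equal numerals, so both sides take the same transition. -/
theorem logRel_compatible (h_decomp : Decomposable 𝔓) (h_open : ∀ P ∈ 𝔓, ScottOpen P) :
    Compatible (logRel 𝔓) where
  var Γ A x n θ η h := h A x
  star Γ n θ η h := by
    simp only [stepRel, valRel]
  lam Γ As s t hst n θ η h := by
    refine valRel_neg.2 fun m hm w w' hw => ?_
    refine obsPreStep_of_red h_open (.beta _ w) (.beta _ w') ?_
    rw [Tm.insts_subst_lifts, Tm.insts_subst_lifts]
    exact hst m _ _ (hw.append (h.mono hm))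
  zero Γ n θ η h := valRel_nat.2 rfl
  succ Γ v v' hv n θ η h := valRel_nat.2 (congrArg Tm.succ (valRel_nat.1 (hv n θ η h)))
  app Γ As v v' w w' hv hw n θ η h :=
    valRel_neg.1 (hv n θ η h) n le_rfl _ _ fun A x => hw A x n θ η h
  mu Γ As v v' w w' hv hw n θ η h := by
    refine obsPreStep_mu h_open (fun m hm u u' hu => ?_) _ _ fun A x => hw A x n θ η h
    rw [Tm.inst_subst_lift, Tm.inst_subst_lift]
    exact hv m _ _ (subRel.cons hu (h.mono hm))
  op Γ σ v v' t t' hv ht n θ η h := by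
    have hv := valRel_nat.1 (hv n θ η h)
    change obsPreStep 𝔓 n (.op σ (v.subst θ) _) (.op σ (v'.subst η) _)
    rw [← hv, ← num_toNat (v.subst θ)]
    refine obsPreStep_op h_decomp h_open (.op _ _ _) (.op _ _ _) fun i => ?_
    rw [Tm.inst_subst_lift, Tm.inst_subst_lift]
    exact ht n _ _ (subRel.cons (valRel_nat.2 rfl) h)
  halt Γ n θ η h := obsPreStep_refl h_open n _
  case Γ v v' s s' t t' hv hs ht n θ η h := by
    have hv := valRel_nat.1 (hv n θ η h)
    change obsPreStep 𝔓 n (.case (v.subst θ) _ _) (.case (v'.subst η) _ _)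
    rw [← hv, ← num_toNat (v.subst θ)]
    cases toNat (v.subst θ) with
    | zero => exact obsPreStep_of_red h_open (.case_zero _ _) (.case_zero _ _) (hs n θ η h)
    | succ i =>
      refine obsPreStep_of_red h_open (.case_succ _ _ _) (.case_succ _ _ _) ?_
      rw [Tm.inst_subst_lift, Tm.inst_subst_lift]
      exact ht n _ _ (subRel.cons (valRel_nat.2 rfl) h)

/-! ## Compatible relations -/

theorem Compatible.refl {R : OpenRel Sig} (hR : Compatible R) {Γ : Ctx} {K : Kind}
    (t : Tm Sig Γ K) : R Γ K t t := by
  induction t with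
  | var x => exact hR.var _ _ x
  | zero => exact hR.zero _
  | succ v hv => exact hR.succ _ _ _ hv
  | star => exact hR.star _
  | lam As t ht => exact hR.lam _ _ _ _ ht
  | app v w hv hw => exact hR.app _ _ _ _ _ _ hv hw
  | mu v w hv hw => exact hR.mu _ _ _ _ _ _ hv hw
  | op σ v t hv ht => exact hR.op _ _ _ _ _ _ hv ht
  | halt => exact hR.halt _
  | case v s t hv hs ht => exact hR.case _ _ _ _ _ _ _ hv hs ht

theorem Compatible.flip {R : OpenRel Sig} (hR : Compatible R) :
    Compatible (fun Γ K s t => R Γ K t s) where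
  var := hR.var
  star := hR.star
  lam _ _ _ _ h := hR.lam _ _ _ _ h
  zero := hR.zero
  succ _ _ _ h := hR.succ _ _ _ h
  app _ _ _ _ _ _ h h' := hR.app _ _ _ _ _ _ h h'
  mu _ _ _ _ _ _ h h' := hR.mu _ _ _ _ _ _ h h'
  op _ _ _ _ _ _ h h' := hR.op _ _ _ _ _ _ h h'
  halt := hR.halt
  case _ _ _ _ _ _ _ h h' h'' := hR.case _ _ _ _ _ _ _ h h' h''

theorem Compatible.inter {R S : OpenRel Sig} (hR : Compatible R) (hS : Compatible S) :
    Compatible (fun Γ K s t => R Γ K s t ∧ S Γ K s t) where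
  var _ _ x := ⟨hR.var _ _ x, hS.var _ _ x⟩
  star _ := ⟨hR.star _, hS.star _⟩
  lam _ _ _ _ h := ⟨hR.lam _ _ _ _ h.1, hS.lam _ _ _ _ h.2⟩
  zero _ := ⟨hR.zero _, hS.zero _⟩
  succ _ _ _ h := ⟨hR.succ _ _ _ h.1, hS.succ _ _ _ h.2⟩
  app _ _ _ _ _ _ h h' := ⟨hR.app _ _ _ _ _ _ h.1 fun A x => (h' A x).1,
    hS.app _ _ _ _ _ _ h.2 fun A x => (h' A x).2⟩
  mu _ _ _ _ _ _ h h' := ⟨hR.mu _ _ _ _ _ _ h.1 fun A x => (h' A x).1,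
    hS.mu _ _ _ _ _ _ h.2 fun A x => (h' A x).2⟩
  op _ _ _ _ _ _ h h' := ⟨hR.op _ _ _ _ _ _ h.1 h'.1, hS.op _ _ _ _ _ _ h.2 h'.2⟩
  halt _ := ⟨hR.halt _, hS.halt _⟩
  case _ _ _ _ _ _ _ h h' h'' := ⟨hR.case _ _ _ _ _ _ _ h.1 h'.1 h''.1,
    hS.case _ _ _ _ _ _ _ h.2 h'.2 h''.2⟩

/-! ## Similarity coincides with the logical relation -/

theorem openExt_nil {R : ClosedRel Sig} {K : Kind} {s t : Tm Sig [] K} :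
    openExt R [] K s t ↔ R K s t := by
  simp only [openExt, Tm.subst_closed]
  exact ⟨fun h => h Sub.id, fun h _ => h⟩

theorem stepRel_refl (h_decomp : Decomposable 𝔓) (h_open : ∀ P ∈ 𝔓, ScottOpen P) (n : ℕ)
    {K : Kind} (t : Tm Sig [] K) : stepRel 𝔓 n K t t := by
  have h := (logRel_compatible h_decomp h_open).refl t n Sub.id Sub.id fun A x => nomatch x
  rwa [Tm.subst_closed] at h

theorem subRel_refl (h_decomp : Decomposable 𝔓) (h_open : ∀ P ∈ 𝔓, ScottOpen P) (n : ℕ)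
    {Γ : Ctx} (θ : Sub Sig Γ []) : subRel 𝔓 n θ θ :=
  fun A x => stepRel_refl h_decomp h_open n (K := .val A) (θ A x)

/-- The right-hand term is observed in full, so similarity composes there without changing the
index. -/
theorem stepRel.trans_similarity {n : ℕ} {K : Kind} {r s t : Tm Sig [] K}
    (h : stepRel 𝔓 n K r s) (hst : similarity 𝔓 K s t) : stepRel 𝔓 n K r t := by
  match K, r, s, t, h, hst with
  | .val .unit, _, _, _, h, _ => simp only [stepRel, valRel]
  | .val .nat, v, u, u', h, hu => exact hu ▸ h
  | .val (.neg As), v, u, u', h, hu =>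
    exact valRel_neg.2 fun m hm w w' hw P hP hv =>
      hu w' P hP (valRel_neg.1 h m hm w w' hw P hP hv)
  | .comp, r, s, t, h, hst => exact fun P hP hr => hst P hP (h P hP hr)

theorem similarity_of_stepRel (h_decomp : Decomposable 𝔓) (h_open : ∀ P ∈ 𝔓, ScottOpen P)
    {K : Kind} {s t : Tm Sig [] K} (h : ∀ n, stepRel 𝔓 n K s t) : similarity 𝔓 K s t := by
  match K, s, t, h with
  | .val .unit, _, _, _ => trivial
  | .val .nat, v, u, h => exact valRel_nat.1 (h 0)
  | .val (.neg As), v, u, h =>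
    exact fun w => (obsPre_iff h_open).2 fun n =>
      valRel_neg.1 (h n) n le_rfl w w (subRel_refl h_decomp h_open n w)
  | .comp, s, t, h => exact (obsPre_iff h_open).2 h

/-- From left to right, reflexivity of `logRel` at `s` replaces `θ` by `η`, and similarity under `η`
then replaces `s` by `t`. The converse uses diagonal substitutions `θ`, `θ` at every index. -/
theorem openExt_similarity (h_decomp : Decomposable 𝔓) (h_open : ∀ P ∈ 𝔓, ScottOpen P) :
    openExt (similarity 𝔓) = logRel 𝔓 := by
  funext Γ K s t
  refine propext ⟨fun h n θ η hθ => ?_, fun h θ => ?_⟩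
  · exact ((logRel_compatible h_decomp h_open).refl s n θ η hθ).trans_similarity (h η)
  · exact similarity_of_stepRel h_decomp h_open fun n =>
      h n θ θ (subRel_refl h_decomp h_open n θ)

theorem openExt_similarity_compatible (h_decomp : Decomposable 𝔓)
    (h_open : ∀ P ∈ 𝔓, ScottOpen P) : Compatible (openExt (similarity 𝔓)) := by
  rw [openExt_similarity h_decomp h_open]
  exact logRel_compatible h_decomp h_open

theorem openExt_similarity_adequate : Adequate 𝔓 (openExt (similarity 𝔓)) :=
  fun _ _ h => openExt_nil.1 h

/-! ## The logics -/

/-- For `maps`, both functions are tested on the same arguments, so similarity applies directly and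
the argument formulas play no role. -/
theorem Formula.Sat.of_similarity {A : Ty} {φ : Formula 𝔓 A} (hφ : φ.Positive) {v u : Val Sig [] A}
    (h : similarity 𝔓 (.val A) v u) (hv : φ.Sat v) : φ.Sat u := by
  induction φ with
  | single n =>
    simp only [similarity] at h
    exact h ▸ hv
  | maps φ P hP ih => exact fun w hw => h w P hP (hv w hw)
  | disj I φ ih =>
    obtain ⟨j, hj⟩ := hv
    exact ⟨j, ih j (hφ j) h hj⟩
  | conj I φ ih => exact fun j => ih j (hφ j) h (hv j)
  | not φ ih => exact hφ.elim

theorem Formula.sat_iff_of_similarity {A : Ty} (φ : Formula 𝔓 A) {v u : Val Sig [] A}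
    (h : similarity 𝔓 (.val A) v u) (h' : similarity 𝔓 (.val A) u v) : φ.Sat v ↔ φ.Sat u := by
  induction φ with
  | single n =>
    simp only [similarity] at h
    rw [h]
  | maps φ P hP ih =>
    exact ⟨fun hv w hw => h w P hP (hv w hw), fun hu w hw => h' w P hP (hu w hw)⟩
  | disj I φ ih => exact exists_congr fun j => ih j h h'
  | conj I φ ih => exact forall_congr' fun j => ih j h h'
  | not φ ih => exact not_congr (ih h h')

/-- Within a class `Q` of formulas that is closed under conjunctions there is a least formula that
is satisfied by `w`. -/
theorem exists_characteristic_formula {A : Ty} (Q : Formula 𝔓 A → Prop)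
    (h_conj : ∀ (I : Type u) (φ : I → Formula 𝔓 A), (∀ j, Q (φ j)) → Q (.conj I φ))
    (w : Val Sig [] A) :
    ∃ χ, Q χ ∧ χ.Sat w ∧ ∀ w', χ.Sat w' → ∀ φ, Q φ → φ.Sat w → φ.Sat w' := by
  -- One separating formula is chosen per value. Indexing by values keeps the conjunction in `Type
  -- u`, whereas the formulas themselves form a type in `Type (u + 1)`.
  let I := {w' : Val Sig [] A // ∃ φ, Q φ ∧ φ.Sat w ∧ ¬ φ.Sat w'}
  choose φ hQ hw hw' using fun j : I => j.2
  refine ⟨.conj I φ, h_conj I φ hQ, hw, fun w' h ψ hψ hψw => ?_⟩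
  by_contra hψw'
  exact hw' ⟨w', ψ, hψ, hψw, hψw'⟩ (h ⟨w', ψ, hψ, hψw, hψw'⟩)

/-- Similarity contains the logical preorder of every class of formulas that is closed under
conjunctions and contains the basic formulas. -/
theorem similarity_of_formulas (h_decomp : Decomposable 𝔓) (h_open : ∀ P ∈ 𝔓, ScottOpen P)
    (Q : ∀ A, Formula 𝔓 A → Prop) (h_single : ∀ n, Q .nat (.single n))
    (h_maps : ∀ As (φ : ∀ A, Var As A → Formula 𝔓 A) P hP, (∀ A x, Q A (φ A x)) →
      Q (.neg As) (.maps φ P hP))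
    (h_conj : ∀ A (I : Type u) (φ : I → Formula 𝔓 A), (∀ j, Q A (φ j)) → Q A (.conj I φ)) :
    ∀ (A : Ty) (v u : Val Sig [] A), (∀ φ, Q A φ → φ.Sat v → φ.Sat u) →
      similarity 𝔓 (.val A) v u
  | .unit, _, _, _ => trivial
  | .nat, v, u, h => by
    have hu : u = num (toNat v) := h _ (h_single (toNat v)) (num_toNat v).symm
    exact ((num_toNat v).symm.trans hu.symm :)
  | .neg As, v, u, h => by
    intro w P hP hvw
    choose χ hQ hw hχ using fun A (x : Var As A) =>
      exists_characteristic_formula (Q A) (h_conj A) (w A x)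
    -- It remains that `v` satisfies the test formula: tuples satisfying `χ` are above `w` by
    -- recursion on the argument types, and compatibility carries the observation from `v(w)` to
    -- `v(w')`.
    refine h (.maps χ P hP) (h_maps As χ P hP hQ) (fun w' hw' => ?_) w hw
    have hww' : ∀ A x, similarity 𝔓 (.val A) (w A x) (w' A x) := fun A x =>
      similarity_of_formulas h_decomp h_open Q h_single h_maps h_conj A _ _
        (hχ A x (w' A x) (hw' A x))
    have hR := openExt_similarity_compatible h_decomp h_open
    exact openExt_nil.1 (hR.app [] As v v w w' (hR.refl v) fun A x => openExt_nil.2 (hww' A x))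
      P hP hvw
termination_by A => sizeOf A
decreasing_by
  have := x.sizeOf_lt
  simp only [Ty.neg.sizeOf_spec]
  omega

theorem logPrePos_eq_similarity (h_decomp : Decomposable 𝔓) (h_open : ∀ P ∈ 𝔓, ScottOpen P) :
    logPrePos 𝔓 = similarity 𝔓 := by
  funext K s t
  cases K with
  | val A =>
    refine propext ⟨fun h => ?_, fun h φ hφ => .of_similarity hφ h⟩
    exact similarity_of_formulas h_decomp h_open (fun A φ => φ.Positive) (fun _ => trivial)
      (fun _ _ _ _ h => h) (fun _ _ _ h => h) A s t h
  | comp => rfl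

theorem logPre.similarity (h_decomp : Decomposable 𝔓) (h_open : ∀ P ∈ 𝔓, ScottOpen P)
    {K : Kind} {s t : Tm Sig [] K} (h : logPre 𝔓 K s t) : similarity 𝔓 K s t := by
  cases K with
  | val A =>
    exact similarity_of_formulas h_decomp h_open (fun _ _ => True) (fun _ => trivial)
      (fun _ _ _ _ _ => trivial) (fun _ _ _ _ => trivial) A s t fun φ _ => h φ
  | comp => exact h

theorem bisimilarity_eq_logEquiv (h_decomp : Decomposable 𝔓) (h_open : ∀ P ∈ 𝔓, ScottOpen P) :
    bisimilarity 𝔓 = logEquiv 𝔓 := by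
  funext K s t
  rw [bisimilarity_iff]
  refine propext ⟨fun h => ?_, fun h =>
    ⟨h.1.similarity h_decomp h_open, h.2.similarity h_decomp h_open⟩⟩
  cases K with
  | val A =>
    exact ⟨fun φ => (φ.sat_iff_of_similarity h.1 h.2).1,
      fun φ => (φ.sat_iff_of_similarity h.1 h.2).2⟩
  | comp => exact h

/-! ## The contextual preorder -/

theorem Ren.lift_id {Γ : Ctx} (B : Ty) : Ren.lift (fun _ (x : Var Γ _) => x) B = fun _ x => x := by
  funext A x
  cases x <;> rfl

theorem Ren.lifts_id {Γ : Ctx} (As : List Ty) :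
    Ren.lifts (fun _ (x : Var Γ _) => x) As = fun _ x => x := by
  induction As with
  | nil => rfl
  | cons B As ih =>
    rw [Ren.lifts, ih, Ren.lift_id]
    rfl

theorem Tm.rename_id {Γ : Ctx} {K : Kind} (t : Tm Sig Γ K) : t.rename (fun _ x => x) = t := by
  induction t <;> simp_all only [Tm.rename, Ren.lift_id, Ren.lifts_id]

theorem Var.here_heq {Γ Δ : Ctx} (h : Γ = Δ) {A : Ty} :
    HEq (Var.here : Var (A :: Γ) A) (Var.here : Var (A :: Δ) A) := by
  subst h
  rfl

theorem Var.there_heq {Γ Δ : Ctx} (h : Γ = Δ) {A B : Ty} {x : Var Γ A} {y : Var Δ A}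
    (hxy : HEq x y) : HEq (x.there : Var (B :: Γ) A) (y.there : Var (B :: Δ) A) := by
  subst h
  rw [eq_of_heq hxy]

theorem Ren.inl_heq {As : List Ty} {A : Ty} (x : Var As A) :
    HEq (Ren.inl (Γ := []) As A x) x := by
  induction x with
  | here => exact Var.here_heq (List.append_nil _)
  | there x ih => exact Var.there_heq (List.append_nil _) ih

/-- A λ-abstraction in the empty context has its body in `Γ ++ []`, which equals `Γ` only
propositionally. Renaming along a heterogeneous identity takes the place of a cast. -/
theorem OpenRel.rename_of_heq {R : OpenRel Sig} {Γ Δ : Ctx} (h : Δ = Γ) {K : Kind}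
    {s t : Tm Sig Γ K} (hst : R Γ K s t) {ρ : Ren Γ Δ} (hρ : ∀ A x, HEq (ρ A x) x) :
    R Δ K (s.rename ρ) (t.rename ρ) := by
  subst h
  have h : ρ = fun _ x => x := by
    funext A x
    exact eq_of_heq (hρ A x)
  rwa [h, Tm.rename_id, Tm.rename_id]

/-- A compatible adequate relation is contained in the open extension of the observational
preorder. -/
theorem Compatible.obsPre_subst {R : OpenRel Sig} (hR : Compatible R) (hA : Adequate 𝔓 R)
    {Γ : Ctx} {s t : Comp Sig Γ} (h : R Γ .comp s t) (θ : Sub Sig Γ []) :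
    obsPre 𝔓 (s.subst θ) (t.subst θ) := by
  -- Abstracting all of `Γ` and applying to `θ` is a closed context whose β-reduct is `r.subst θ`.
  have h_tree (r : Comp Sig Γ) :
      tree (.app (.lam Γ (r.rename (Ren.inl Γ))) θ) = tree (r.subst θ) := by
    rw [tree_eq_of_red (.beta _ θ), Tm.insts, Tm.subst_rename]
    simp only [Sub.append_inl]
  have h' := hR.lam [] Γ _ _ (OpenRel.rename_of_heq (List.append_nil Γ) h
    fun _ => Ren.inl_heq)
  intro P hP
  rw [← h_tree, ← h_tree]
  exact hA _ _ (hR.app _ _ _ _ θ θ h' fun A x => hR.refl _) P hP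

/-- A computation that diverges. -/
def diverge {Γ : Ctx} : Comp Sig Γ := .mu (As := []) (.var .here) (fun _ x => nomatch x)

theorem diverge_subst {Γ Δ : Ctx} (θ : Sub Sig Γ Δ) : (diverge : Comp Sig Γ).subst θ = diverge := by
  simp only [diverge, Tm.subst, Sub.lift, Sub.cons]
  congr 1
  funext A x
  cases x

theorem approx_diverge (n : ℕ) : approx n (diverge : Comp Sig []) = Tree.bot := by
  induction n using Nat.strong_induction_on with
  | _ n ih =>
    -- Unfolding and β-reduction lead back to `diverge` after two steps, hence two base cases.
    match n with
    | 0 => rfl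
    | 1 => rfl
    | n + 2 =>
      rw [diverge, approx_succ_of_red (.mu _ _)]
      refine (approx_succ_of_red (.beta _ _) n).trans ?_
      rw [insts_unroll]
      exact ih n (by omega)

theorem tree_diverge : tree (diverge : Comp Sig []) = Tree.bot :=
  le_antisymm (tree_le fun n => (approx_diverge n).le) (Tree.bot_le _)

/-- The computation that behaves like `t` if the first variable is the numeral `n`, and diverges
otherwise. -/
def numTest (t : Comp Sig []) : ℕ → (Γ : Ctx) → Comp Sig (.nat :: Γ)
  | 0, _ => .case (.var .here) (t.rename fun _ x => nomatch x) diverge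
  | n + 1, Γ => .case (.var .here) diverge (numTest t n (.nat :: Γ))

/-- Each `case` peels off one successor and binds the predecessor as a new first variable, so the
context and `θ` vary in the induction. -/
theorem tree_numTest (t : Comp Sig []) (n m : ℕ) {Γ : Ctx} (θ : Sub Sig Γ []) :
    tree ((numTest t n Γ).subst (Sub.cons (num m) θ)) = if n = m then tree t else Tree.bot := by
  induction n generalizing Γ m with
  | zero =>
    cases m with
    | zero =>
      refine (tree_eq_of_red (.case_zero _ _)).trans ?_
      rw [Tm.subst_rename_closed, if_pos rfl]
    | succ m =>
      refine (tree_eq_of_red (.case_succ _ _ _)).trans ?_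
      rw [Tm.inst_subst_lift, diverge_subst, tree_diverge, if_neg (Nat.succ_ne_zero m).symm]
  | succ n ih =>
    cases m with
    | zero =>
      refine (tree_eq_of_red (.case_zero _ _)).trans ?_
      rw [diverge_subst, tree_diverge, if_neg (Nat.succ_ne_zero n)]
    | succ m =>
      refine (tree_eq_of_red (.case_succ _ _ _)).trans ?_
      rw [Tm.inst_subst_lift, ih]
      simp only [Nat.add_right_cancel_iff]

/-- Were the numerals different, the test for the first would run `t` on one side and diverge on the
other. Adequacy would put `⊥` in `P`, and upward closure would make `P` the set of all trees,
against consistency. -/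
theorem Compatible.subst_nat_eq (h_open : ∀ P ∈ 𝔓, ScottOpen P) (h_cons : Consistent 𝔓)
    {R : OpenRel Sig} (hR : Compatible R) (hA : Adequate 𝔓 R) {Γ : Ctx} {v u : Val Sig Γ .nat}
    (h : R Γ (.val .nat) v u) (θ : Sub Sig Γ []) : v.subst θ = u.subst θ := by
  obtain ⟨P, hP, hne, t, ht⟩ := h_cons
  let D (z : Val Sig Γ .nat) : Comp Sig Γ :=
    .app (.lam [.nat] (numTest t (toNat (v.subst θ)) Γ)) (Sub.cons z fun _ x => nomatch x)
  have h_tree (z : Val Sig Γ .nat) : tree ((D z).subst θ) =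
      if toNat (v.subst θ) = toNat (z.subst θ) then tree t else Tree.bot := by
    refine (tree_eq_of_red (.beta _ _)).trans ?_
    rw [Tm.insts_subst_lifts, ← tree_numTest t _ _ θ, num_toNat]
    rfl
  have hD : R Γ .comp (D v) (D u) := by
    refine hR.app _ _ _ _ _ _ (hR.refl _) fun A x => ?_
    rcases x with _ | x
    · exact h
    · cases x
  have h_obs := hR.obsPre_subst hA hD θ P hP
  rw [h_tree, h_tree, if_pos rfl] at h_obs
  by_cases heq : toNat (v.subst θ) = toNat (u.subst θ)
  · rw [← num_toNat (v.subst θ), heq, num_toNat]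
  · rw [if_neg heq] at h_obs
    exact absurd (Set.eq_univ_of_forall fun a => (h_open P hP).1 _ a (h_obs ht) (Tree.bot_le a)) hne

theorem Compatible.le_openExt_similarity (h_open : ∀ P ∈ 𝔓, ScottOpen P) (h_cons : Consistent 𝔓)
    {R : OpenRel Sig} (hR : Compatible R) (hA : Adequate 𝔓 R) {Γ : Ctx} {K : Kind}
    {s t : Tm Sig Γ K} (h : R Γ K s t) : openExt (similarity 𝔓) Γ K s t := by
  intro θ
  match K, s, t, h with
  | .val .unit, _, _, _ => trivial
  | .val .nat, v, u, h => exact hR.subst_nat_eq h_open h_cons hA h θ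
  | .val (.neg As), v, u, h =>
    intro w
    -- The closed arguments are weakened to `Γ` so that the application is formed in the context of
    -- `h`; substituting `θ` gives them back unchanged.
    have hvu := hR.obsPre_subst hA
      (hR.app _ _ _ _ (fun A x => (w A x).rename fun _ y => nomatch y) _ h fun A x => hR.refl _) θ
    simpa only [Tm.subst, Tm.subst_rename_closed] using hvu
  | .comp, s, t, h => exact hR.obsPre_subst hA h θ

theorem openExt_similarity_eq_ctxPre (h_decomp : Decomposable 𝔓) (h_open : ∀ P ∈ 𝔓, ScottOpen P)
    (h_cons : Consistent 𝔓) : openExt (similarity 𝔓) = ctxPre 𝔓 := by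
  funext Γ K s t
  refine propext ⟨fun h => ?_, ?_⟩
  · exact ⟨_, openExt_similarity_compatible h_decomp h_open, openExt_similarity_adequate, h⟩
  · rintro ⟨R, hR, hA, h⟩
    exact hR.le_openExt_similarity h_open h_cons hA h

theorem openExt_bisimilarity_eq_ctxEquiv (h_decomp : Decomposable 𝔓)
    (h_open : ∀ P ∈ 𝔓, ScottOpen P) (h_cons : Consistent 𝔓) :
    openExt (bisimilarity 𝔓) = ctxEquiv 𝔓 := by
  have hS := openExt_similarity_compatible h_decomp h_open
  funext Γ K s t
  have h_iff : openExt (bisimilarity 𝔓) Γ K s t ↔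
      openExt (similarity 𝔓) Γ K s t ∧ openExt (similarity 𝔓) Γ K t s := by
    simp only [openExt, bisimilarity_iff, forall_and]
  rw [h_iff]
  -- The witness is similarity intersected with its converse. In the other direction, a biadequate
  -- relation and its converse are both compatible and adequate, so each lies in open similarity.
  refine propext ⟨fun h => ⟨_, hS.inter hS.flip, fun s t hst P hP => ?_, h⟩, ?_⟩
  · exact ⟨openExt_similarity_adequate _ _ hst.1 P hP, openExt_similarity_adequate _ _ hst.2 P hP⟩
  · rintro ⟨R, hR, hA, h⟩
    exact ⟨hR.le_openExt_similarity h_open h_cons (fun s t h P hP => (hA s t h P hP).1) h,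
      hR.flip.le_openExt_similarity h_open h_cons (fun s t h P hP => (hA t s h P hP).2) h⟩

end ECPS

theorem mainTheorem1 {Sig : Type u} (𝔓 : Set (Set (ECPS.Tree Sig)))
    (h_decomp : ECPS.Decomposable 𝔓)
    (h_open : ∀ P ∈ 𝔓, ECPS.ScottOpen P)
    (h_cons : ECPS.Consistent 𝔓) :
    ECPS.openExt (ECPS.logPrePos 𝔓) = ECPS.ctxPre 𝔓 ∧
    ECPS.openExt (ECPS.logEquiv 𝔓) = ECPS.ctxEquiv 𝔓 ∧
    ECPS.bisimilarity 𝔓 = ECPS.logEquiv 𝔓 ∧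
    ECPS.openExt (ECPS.bisimilarity 𝔓) = ECPS.ctxEquiv 𝔓 := by
  have h_bisim := ECPS.bisimilarity_eq_logEquiv h_decomp h_open
  have h_ctx := ECPS.openExt_bisimilarity_eq_ctxEquiv h_decomp h_open h_cons
  refine ⟨?_, h_bisim ▸ h_ctx, h_bisim, h_ctx⟩
  rw [ECPS.logPrePos_eq_similarity h_decomp h_open]
  exact ECPS.openExt_similarity_eq_ctxPre h_decomp h_open h_cons
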